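/- Let $A$ be an artin algebra (an algebra over a commutative artinian ring $R$ that is finitely generated as an $R$-module), let $\mathrm{proj}\,A$ be the category of finitely generated projective $A$-modules, and let $n\ge 1$ be an integer. For integers $m\le n$ let $\mathbf{C}_{[m,n]}(\mathrm{proj}\,A)$ be the full subcategory of the category of cochain complexes of $A$-modules consisting of the complexes $(X^i,d_X^i)_{i\in\mathbb{Z}}$ with $X^i\in\mathrm{proj}\,A$ for all $i$ and $X^i=0$ for $i\notin\{m,\dots,n\}$; write $\mathbf{C}_n(\mathrm{proj}\,A)=\mathbf{C}_{[1,n]}(\mathrm{proj}\,A)$, viewed as a full subcategory of $\mathbf{C}_{[0,n]}(\mathrm{proj}\,A)$. Let $F:\mathbf{C}_{[0,n]}(\mathrm{proj}\,A)\to\mathbf{C}_n(\mathrm{proj}\,A)$ be the hard truncation functor, which replaces the term in degree $0$ by zero. If $X$ is an indecomposable complex in $\mathbf{C}_n(\mathrm{proj}\,A)$, a left enlargement of $X$ is an indecomposable complex $Z$ in $\mathbf{C}_{[0,n]}(\mathrm{proj}\,A)$ such that $Z^0\neq 0$ and $X$ is a direct summand of $F(Z)$. A morphism $f$ of a category is irreducible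 if it is neither a section nor a retraction and, whenever $f=hg$, either $g$ is a section or $h$ is a retraction. Let $X$ be an indecomposable complex in $\mathbf{C}_n(\mathrm{proj}\,A)$, let $\overleftarrow{X}$ be a left enlargement of $X$, and let $f:X\to\overleftarrow{X}$ be an irreducible morphism in $\mathbf{C}_{[0,n]}(\mathrm{proj}\,A)$. Assume that $\overleftarrow{X}$ has the diagonal form $$Z^0\xrightarrow{\begin{pmatrix}\widetilde d_X^{\,0}\\ \widetilde d_Y^{\,0}\end{pmatrix}}X^1\oplus Y^1\xrightarrow{\begin{pmatrix}d_X^1&0\\0&d_Y^1\end{pmatrix}}X^2\oplus Y^2\longrightarrow\cdots\xrightarrow{\begin{pmatrix}d_X^{n-1}&0\\0&d_Y^{n-1}\end{pmatrix}}X^n\oplus Y^n$$ for some complex $Y$ in $\mathbf{C}_n(\mathrm{proj}\,A)$. Then the socle $\mathrm{soc}(\mathrm{Ker}\,d_X^1)$, where $d_X^1:X^1\to X^2$, has a projective cover, and $Z^0$ is a direct summand of it. -/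

import Mathlib

open CategoryTheory CategoryTheory.Limits

universe u v w

namespace ProjComplexes

/-! ### General categorical notions -/

section Category

variable {C : Type v} [Category.{w} C]

/-- A morphism `f : X ⟶ Y` is *irreducible* if it is neither a section (split monomorphism) nor
a retraction (split epimorphism), and in every factorization `f = h ∘ g` either `g` is a section
or `h` is a retraction. -/
structure IsIrreducible {X Y : C} (f : X ⟶ Y) : Prop where
  not_section : ¬ IsSplitMono f
  not_retraction : ¬ IsSplitEpi f
  factor : ∀ {W : C} (g : X ⟶ W) (h : W ⟶ Y), g ≫ h = f → IsSplitMono g ∨ IsSplitEpi h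

/-- `X` is a *direct summand* of `Z` if `Z ≅ X ⊞ Y` for some object `Y`. -/
def IsDirectSummand [HasZeroMorphisms C] [HasBinaryBiproducts C] (X Z : C) : Prop :=
  ∃ Y : C, Nonempty (Z ≅ X ⊞ Y)

end Category

/-! ### Modules: socle and projective cover -/

section Module

variable (A : Type u) [Ring A]

/-- The socle of a module: the sum of its simple submodules. -/
def socle (M : Type v) [AddCommGroup M] [Module A M] : Submodule A M :=
  sSup {S : Submodule A M | IsSimpleModule A S}

variable {A}

/-- `π : P → M` is a *projective cover* of `M`: `P` is projective, `π` is surjective and the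
kernel of `π` is superfluous (small) in `P`. -/
structure IsProjectiveCover {P : Type v} [AddCommGroup P] [Module A P]
    {M : Type w} [AddCommGroup M] [Module A M] (π : P →ₗ[A] M) : Prop where
  projective : Module.Projective A P
  surjective : Function.Surjective π
  superfluous : ∀ N : Submodule A P, N ⊔ LinearMap.ker π = ⊤ → N = ⊤

end Module

/-! ### Complexes of fixed size -/

section Complexes

variable (A : Type u) [Ring A]

/-- The complexes of finitely generated projective `A`-modules that are concentrated in the
degrees of the interval `[m, n]`. -/
def projComplex (m n : ℤ) : ObjectProperty (CochainComplex (ModuleCat.{u} A) ℤ) := fun X =>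
  (∀ i : ℤ, Module.Finite A (X.X i) ∧ Module.Projective A (X.X i)) ∧
    ∀ i : ℤ, i ∉ Set.Icc m n → IsZero (X.X i)

/-- The category `C_[m,n](proj A)`, as a full subcategory of the category of complexes of
`A`-modules. The category `C_n(proj A)` is `Cplx A 1 n`. -/
abbrev Cplx (m n : ℤ) : Type (u + 1) := (projComplex A m n).FullSubcategory

variable {A}

lemma projComplex_biprod {m n : ℤ} {X Y : CochainComplex (ModuleCat.{u} A) ℤ}
    (hX : projComplex A m n X) (hY : projComplex A m n Y) : projComplex A m n (X ⊞ Y) := by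
  refine ⟨fun i => ?_, fun i hi => ?_⟩
  · have e : (X ⊞ Y).X i ≃ₗ[A] (X.X i × Y.X i) :=
      (HomologicalComplex.biprodXIso X Y i ≪≫ ModuleCat.biprodIsoProd _ _).toLinearEquiv
    obtain ⟨h₁, h₂⟩ := hX.1 i
    obtain ⟨h₃, h₄⟩ := hY.1 i
    exact ⟨Module.Finite.equiv e.symm, Module.Projective.of_equiv e.symm⟩
  · exact IsZero.of_iso ((biprod_isZero_iff _ _).2 ⟨hX.2 i hi, hY.2 i hi⟩)
      (HomologicalComplex.biprodXIso X Y i)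

instance (m n : ℤ) : HasBinaryBiproducts (Cplx A m n) where
  has_binary_biproduct X Y :=
    let P : Cplx A m n := ⟨X.obj ⊞ Y.obj, projComplex_biprod X.property Y.property⟩
    hasBinaryBiproduct_of_total
      { pt := P
        fst := ObjectProperty.homMk (X := P) (Y := X) biprod.fst
        snd := ObjectProperty.homMk (X := P) (Y := Y) biprod.snd
        inl := ObjectProperty.homMk (X := X) (Y := P) biprod.inl
        inr := ObjectProperty.homMk (X := Y) (Y := P) biprod.inr
        inl_fst := ObjectProperty.hom_ext _ biprod.inl_fst
        inl_snd := ObjectProperty.hom_ext _ biprod.inl_snd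
        inr_fst := ObjectProperty.hom_ext _ biprod.inr_fst
        inr_snd := ObjectProperty.hom_ext _ biprod.inr_snd }
      (ObjectProperty.hom_ext _ biprod.total)

variable (A) in
lemma projComplex_le (n : ℤ) : projComplex A 1 n ≤ projComplex A 0 n := fun _ hX =>
  ⟨hX.1, fun i hi => hX.2 i fun h => hi ⟨by linarith [h.1], h.2⟩⟩

variable (A) in
/-- The inclusion of `C_n(proj A)` into `C_[0,n](proj A)`. -/
abbrev incl (n : ℤ) : Cplx A 1 n ⥤ Cplx A 0 n :=
  ObjectProperty.ιOfLE (projComplex_le A n)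

lemma projComplex_stupidTrunc {n : ℤ} {Z : CochainComplex (ModuleCat.{u} A) ℤ}
    (hZ : projComplex A 0 n Z) :
    projComplex A 1 n (Z.stupidTrunc (ComplexShape.embeddingUpIntGE 1)) := by
  have key : ∀ i : ℤ, (Nonempty ((Z.stupidTrunc (ComplexShape.embeddingUpIntGE 1)).X i ≅ Z.X i)) ∨
      (i < 1 ∧ IsZero ((Z.stupidTrunc (ComplexShape.embeddingUpIntGE 1)).X i)) := by
    intro i
    by_cases hi : 1 ≤ i
    · obtain ⟨k, hk⟩ := Int.eq_ofNat_of_zero_le (sub_nonneg.2 hi)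
      exact Or.inl ⟨Z.stupidTruncXIso (ComplexShape.embeddingUpIntGE 1) (i := k)
        (by simp; omega)⟩
    · exact Or.inr ⟨not_le.1 hi, Z.isZero_stupidTrunc_X _ i (fun k => by simp; omega)⟩
  refine ⟨fun i => ?_, fun i hi => ?_⟩
  · obtain ⟨⟨e⟩⟩ | ⟨-, h⟩ := key i
    · obtain ⟨h₁, h₂⟩ := hZ.1 i
      exact ⟨Module.Finite.equiv e.symm.toLinearEquiv,
        Module.Projective.of_equiv e.symm.toLinearEquiv⟩
    · have := ModuleCat.subsingleton_of_isZero h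
      exact ⟨inferInstance, inferInstance⟩
  · obtain ⟨⟨e⟩⟩ | ⟨-, h⟩ := key i
    · by_cases hi₀ : 1 ≤ i
      · exact IsZero.of_iso (hZ.2 i fun h => hi ⟨hi₀, h.2⟩) e
      · exact Z.isZero_stupidTrunc_X _ i (fun k => by simp; omega)
    · exact h

variable (A) in
/-- The hard truncation functor `F : C_[0,n](proj A) ⥤ C_n(proj A)`, which replaces the term in
degree `0` by zero and keeps the terms and differentials in degrees `≥ 1`. -/
noncomputable def hardTrunc (n : ℤ) : Cplx A 0 n ⥤ Cplx A 1 n :=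
  (projComplex A 1 n).lift
    ((projComplex A 0 n).ι ⋙
      (ComplexShape.embeddingUpIntGE 1).stupidTruncFunctor (ModuleCat.{u} A))
    fun Z => projComplex_stupidTrunc Z.property

/-- `Z` in `C_[0,n](proj A)` is a *left enlargement* of the (indecomposable) complex `X` in
`C_n(proj A)`: `Z` is indecomposable, `Z⁰ ≠ 0`, and `X` is a direct summand of the hard truncation
of `Z` in `C_n(proj A)`. -/
structure IsLeftEnlargement {n : ℤ} (X : Cplx A 1 n) (Z : Cplx A 0 n) : Prop where
  indecomposable : Indecomposable Z
  ne_zero : ¬ IsZero (Z.obj.X 0)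
  summand : IsDirectSummand X ((hardTrunc A n).obj Z)

/-- The data that present `Z` as a diagonal complex
`Z⁰ ⟶ X¹ ⊞ Y¹ ⟶ X² ⊞ Y² ⟶ ⋯ ⟶ Xⁿ ⊞ Yⁿ`: the first differential has components
`dX` and `dY`, and the differential in each degree `i ≥ 1` is the diagonal matrix with entries the
differentials of `X` and of `Y`. -/
structure DiagonalForm {n : ℤ} (X Y : Cplx A 1 n) (Z : Cplx A 0 n) where
  /-- the identification of `Zⁱ` with `Xⁱ ⊞ Yⁱ` for `i ≥ 1` -/
  iso : ∀ i : ℤ, 1 ≤ i → (Z.obj.X i ≅ X.obj.X i ⊞ Y.obj.X i)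
  /-- the component `Z⁰ ⟶ X¹` of the first differential -/
  dX : Z.obj.X 0 ⟶ X.obj.X 1
  /-- the component `Z⁰ ⟶ Y¹` of the first differential -/
  dY : Z.obj.X 0 ⟶ Y.obj.X 1
  d_zero : Z.obj.d 0 1 ≫ (iso 1 le_rfl).hom = biprod.lift dX dY
  d_pos : ∀ (i : ℤ) (hi : 1 ≤ i),
    Z.obj.d i (i + 1) ≫ (iso (i + 1) (by omega)).hom =
      (iso i hi).hom ≫ biprod.map (X.obj.d i (i + 1)) (Y.obj.d i (i + 1))

/-- The socle of the kernel of the differential `d¹ : X¹ ⟶ X²`. -/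
abbrev socKer {n : ℤ} (X : Cplx A 1 n) :
    Submodule A (LinearMap.ker (X.obj.d 1 2).hom) :=
  socle A (LinearMap.ker (X.obj.d 1 2).hom)

end Complexes

end ProjComplexes

/-!
Replace the term `Z⁰` by a projective module that maps onto a proper submodule `N` of `Z⁰`. The
irreducible map `f : X ⟶ Z` factors through the resulting complex, and the second factor is not a
retraction because it misses part of `Z⁰`; so the first factor is a section. This yields maps
`rⁱ : Zⁱ → Xⁱ` that form a retraction of `f` in degrees `≥ 1`, with `r¹ ∘ d⁰` vanishing on `N`.

For all such families `r`, the maps `r¹ ∘ d⁰ : Z⁰ → Ker d_X¹` form an `R`-affine space `Φ`. It does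
not contain `0`, since otherwise `f` would be a section, and each proper submodule of `Z⁰` is
annihilated by a member of `Φ`. With `N` the radical of `Z⁰`, this leads to maps from the top `V` of
`Z⁰` to the socle `W` of `Ker d_X¹`. Choose an `R`-linear map `l` from `Hom (V, W)` to a simple
`R`-module that is constant and nonzero on the maps in `Φ`. By duality there is `s : W → V` such
that `φ ∘ s = 0` implies `l φ = 0`. If `s` were not surjective, some member of `Φ` would annihilate
its range, a contradiction. Hence the top of `Z⁰` is a quotient of `W`, and so of any projective
cover `P` of `W`; lifting along `Z⁰ → V` exhibits `Z⁰` as a direct summand of `P`.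
-/

namespace ProjComplexes

section Semisimple

lemma exists_isCoatom_of_notMem {R : Type*} [Ring R] {Q : Type*} [AddCommGroup Q] [Module R Q]
    [IsSemisimpleModule R Q] {N : Submodule R Q} {x : Q} (hx : x ∉ N) :
    ∃ M : Submodule R Q, IsCoatom M ∧ N ≤ M ∧ x ∉ M := by
  have hx' : N.mkQ x ∉ Module.jacobson R (Q ⧸ N) := by
    simpa [IsSemisimpleModule.jacobson_eq_bot] using hx
  rw [Module.jacobson, Submodule.mem_sInf] at hx'
  push Not at hx'
  obtain ⟨M, hM, hxM⟩ := hx'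
  exact ⟨M.comap N.mkQ, (Submodule.isCoatom_comap_iff N.mkQ_surjective).2 hM,
    Submodule.le_comap_mkQ N M, hxM⟩

variable (R A : Type*) [CommRing R] [Ring A] [Algebra R A]

lemma isSemisimpleModule_of_isSimpleModule_algebra [IsArtinianRing R] {S : Type*} [AddCommGroup S]
    [Module A S] [Module R S] [IsScalarTower R A S] [IsSimpleModule A S] :
    IsSemisimpleModule R S := by
  classical
  let I : Ideal R := RingHom.ker (algebraMap R (Module.End A S))
  have : I.IsPrime := RingHom.ker_isPrime _
  have : I.IsMaximal := IsArtinianRing.isMaximal_of_isPrime I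
  have hI : Module.IsTorsionBySet R S I := fun x r =>
    LinearMap.congr_fun (RingHom.mem_ker.1 r.2) x
  let := hI.module
  let := Ideal.Quotient.field I
  exact hI.isSemisimpleModule_iff.1 inferInstance

lemma isSemisimpleModule_of_algebra [IsArtinianRing R] {W : Type*} [AddCommGroup W]
    [Module A W] [Module R W] [IsScalarTower R A W] [IsSemisimpleModule A W] :
    IsSemisimpleModule R W := by
  obtain ⟨s, e, -, hs⟩ := IsSemisimpleModule.exists_linearEquiv_dfinsupp A W
  have (S : s) : IsSemisimpleModule R S.1 := isSemisimpleModule_of_isSimpleModule_algebra R A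
  exact (e.restrictScalars R).isSemisimpleModule_iff.2 inferInstance

lemma exists_injective_linearMap_pi (V W : Type*) [AddCommGroup V] [Module A V]
    [Module.Finite A V] [AddCommGroup W] [Module A W] [Module R W] [IsScalarTower R A W] :
    ∃ (n : ℕ) (g : (V →ₗ[A] W) →ₗ[R] Fin n → W), Function.Injective g := by
  obtain ⟨n, v, hv⟩ := Module.Finite.exists_fin (R := A) (M := V)
  exact ⟨n, LinearMap.pi fun i => LinearMap.applyₗ' R (v i), fun φ ψ h =>
    LinearMap.ext_on_range hv fun i => congr_fun h i⟩

end Semisimple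

section Duality

variable {R : Type*} [CommRing R] {Q L : Type*} [AddCommGroup Q] [Module R Q] [AddCommGroup L]
  [Module R L] [IsSimpleModule R L]

lemma exists_sub_smul_le_ker {N : Submodule R Q} {u l : Q →ₗ[R] L} (hu : ¬ N ≤ LinearMap.ker u)
    (hl : N ⊓ LinearMap.ker u ≤ LinearMap.ker l) : ∃ c : R, N ≤ LinearMap.ker (l - c • u) := by
  obtain ⟨q, hq, huq⟩ := SetLike.not_le_iff_exists.1 hu
  have hspan := IsSimpleModule.toSpanSingleton_surjective R huq
  obtain ⟨c, hc : c • u q = l q⟩ := hspan (l q)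
  refine ⟨c, fun x hx => ?_⟩
  obtain ⟨a, ha : a • u q = u x⟩ := hspan (u x)
  have hlx : l (x - a • q) = 0 := hl ⟨N.sub_mem hx (N.smul_mem a hq), by simp [ha]⟩
  rw [map_sub, map_smul, ← hc, smul_comm, ha] at hlx
  simpa using hlx

theorem eq_top_of_separating [IsArtinian R Q] (U : Submodule R (Q →ₗ[R] L))
    (hU : ∀ q : Q, (∀ u ∈ U, u q = 0) → q = 0) : U = ⊤ := by
  obtain ⟨N, hN, hmin⟩ := exists_minimal_of_wellFoundedLT
    (fun N : Submodule R Q => ∀ l : Q →ₗ[R] L, N ≤ LinearMap.ker l → l ∈ U)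
    ⟨⊤, fun l hl => by rw [LinearMap.ker_eq_top.1 (top_le_iff.1 hl)]; exact U.zero_mem⟩
  have hN_le (u : Q →ₗ[R] L) (hu : u ∈ U) : N ≤ LinearMap.ker u := by
    by_contra hNu
    refine hNu (le_inf_iff.1 (hmin (fun l hl => ?_) inf_le_left)).2
    obtain ⟨c, hc⟩ := exists_sub_smul_le_ker hNu hl
    simpa using U.add_mem (hN _ hc) (U.smul_mem c hu)
  have hN_bot : N = ⊥ := (Submodule.eq_bot_iff N).2 fun q hq => hU q fun u hu => hN_le u hu hq
  exact (Submodule.eq_top_iff'.2 fun l => hN l (hN_bot ▸ bot_le))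

end Duality

section Hom

variable {R : Type*} [CommRing R] {A : Type*} [Ring A] [Algebra R A]
  {V : Type*} [AddCommGroup V] [Module A V] [Module R V] [IsScalarTower R A V]
  [IsSemisimpleModule A V]
  {L : Type*} [AddCommGroup L] [Module R L] [IsSimpleModule R L]

/-- The maps `s : S → V` act on `Hom (V, S)` through the trace-like form `φ ↦ t (φ ∘ s)`. -/
lemma exists_forall_comp_eq_zero_of_isSimpleModule {S : Type*} [AddCommGroup S] [Module A S]
    [Module R S] [IsScalarTower R A S] [IsSimpleModule A S] [IsArtinian R (V →ₗ[A] S)]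
    (l : (V →ₗ[A] S) →ₗ[R] L) :
    ∃ s : S →ₗ[A] V, ∀ φ : V →ₗ[A] S, φ ∘ₗ s = 0 → l φ = 0 := by
  obtain rfl | hl := eq_or_ne l 0
  · exact ⟨0, fun φ _ => rfl⟩
  obtain ⟨φ₀, hφ₀⟩ := DFunLike.ne_iff.1 hl
  let t : (S →ₗ[A] S) →ₗ[R] L := l ∘ₗ LinearMap.lcomp R S φ₀
  have ht : t LinearMap.id ≠ 0 := hφ₀
  let B : (S →ₗ[A] V) →ₗ[R] (V →ₗ[A] S) →ₗ[R] L :=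
    LinearMap.mk₂ R (fun s φ => t (φ ∘ₗ s))
      (fun s s' φ => by rw [LinearMap.comp_add, map_add])
      (fun c s φ => by rw [LinearMap.comp_smul, map_smul])
      (fun s φ φ' => by rw [LinearMap.add_comp, map_add])
      (fun c s φ => by rw [LinearMap.smul_comp, map_smul])
  have hB : LinearMap.range B = ⊤ := eq_top_of_separating _ fun φ hφ => by
    by_contra hne
    obtain ⟨s, hs⟩ := IsSemisimpleModule.lifting_property φ
      (LinearMap.surjective_of_ne_zero hne) LinearMap.id
    exact ht (hs ▸ hφ _ ⟨s, rfl⟩)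
  obtain ⟨s, hs⟩ := LinearMap.range_eq_top.1 hB l
  exact ⟨s, fun φ hφ => by simp [← hs, B, hφ]⟩

lemma exists_forall_comp_eq_zero_of_pi {ι : Type*} [Finite ι] {S : ι → Type*}
    [∀ j, AddCommGroup (S j)] [∀ j, Module A (S j)] [∀ j, Module R (S j)]
    [∀ j, IsScalarTower R A (S j)] [∀ j, IsSimpleModule A (S j)]
    [∀ j, IsArtinian R (V →ₗ[A] S j)] (l : (V →ₗ[A] ∀ j, S j) →ₗ[R] L) :
    ∃ s : (∀ j, S j) →ₗ[A] V, ∀ φ : V →ₗ[A] ∀ j, S j, φ ∘ₗ s = 0 → l φ = 0 := by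
  classical
  have := Fintype.ofFinite ι
  choose s hs using fun j => exists_forall_comp_eq_zero_of_isSimpleModule
    (l ∘ₗ LinearMap.compRight R (M := V) (LinearMap.single A S j))
  refine ⟨LinearMap.lsum A S ℕ s, fun φ hφ => ?_⟩
  have hφs (j : ι) : φ ∘ₗ s j = 0 := by
    ext1 x
    rw [LinearMap.comp_apply, ← LinearMap.lsum_piSingle A S ℕ s j x]
    exact LinearMap.congr_fun hφ (Pi.single j x)
  have hsum : ∑ j, LinearMap.single A S j ∘ₗ LinearMap.proj j ∘ₗ φ = φ := by
    ext1 v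
    simpa using Finset.univ_sum_single (φ v)
  rw [← hsum, map_sum]
  exact Finset.sum_eq_zero fun j _ =>
    hs j _ (by rw [LinearMap.comp_assoc, hφs, LinearMap.comp_zero])

theorem exists_forall_comp_eq_zero {W : Type*} [AddCommGroup W] [Module A W]
    [Module R W] [IsScalarTower R A W] [IsSemisimpleModule A W] [Module.Finite A W]
    [IsArtinian R (V →ₗ[A] W)] (l : (V →ₗ[A] W) →ₗ[R] L) :
    ∃ s : W →ₗ[A] V, ∀ φ : V →ₗ[A] W, φ ∘ₗ s = 0 → l φ = 0 := by
  obtain ⟨n, S, e₀, hS⟩ := IsSemisimpleModule.exists_linearEquiv_fin_dfinsupp A W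
  let e : W ≃ₗ[A] ∀ j, S j := e₀ ≪≫ₗ DFinsupp.linearEquivFunOnFintype
  have (j : Fin n) : IsArtinian R (V →ₗ[A] S j) :=
    isArtinian_of_injective (LinearMap.compRight R (M := V) (S j).subtype)
      fun φ ψ h => (S j).injective_subtype.injective_linearMapComp_left h
  obtain ⟨s, hs⟩ := exists_forall_comp_eq_zero_of_pi
    (l ∘ₗ LinearMap.compRight R (M := V) e.symm.toLinearMap)
  refine ⟨s ∘ₗ e.toLinearMap, fun φ hφ => ?_⟩
  have hlφ := hs (e.toLinearMap ∘ₗ φ) (by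
    rw [LinearMap.comp_assoc]
    refine LinearMap.ext fun x => e.symm.injective ?_
    simpa using LinearMap.congr_fun hφ (e.symm x))
  simpa [LinearMap.compRight, ← LinearMap.comp_assoc] using hlφ

theorem exists_surjective_of_affineSubspace [IsArtinianRing R] [Module.Finite A V] {W : Type*}
    [AddCommGroup W] [Module A W] [Module R W] [IsScalarTower R A W] [IsSemisimpleModule A W]
    [Module.Finite A W] [IsArtinian R W] (Φ : AffineSubspace R (V →ₗ[A] W)) (hΦ : 0 ∉ Φ)
    (hker : ∀ N : Submodule A V, N ≠ ⊤ → ∃ φ ∈ Φ, N ≤ LinearMap.ker φ) :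
    ∃ s : W →ₗ[A] V, Function.Surjective s := by
  obtain _ | _ := subsingleton_or_nontrivial V
  · exact ⟨0, fun v => ⟨0, Subsingleton.elim _ _⟩⟩
  have : IsSemisimpleModule R W := isSemisimpleModule_of_algebra R A
  obtain ⟨n, g, hg⟩ := exists_injective_linearMap_pi R A V W
  have : IsArtinian R (V →ₗ[A] W) := isArtinian_of_injective g hg
  have : IsSemisimpleModule R (V →ₗ[A] W) := .of_injective g hg
  obtain ⟨φ₀, hφ₀, -⟩ := hker ⊥ bot_ne_top
  have hφ₀_dir : φ₀ ∉ Φ.direction := fun h => hΦ <| by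
    simpa using AffineSubspace.vadd_mem_of_mem_direction (Φ.direction.neg_mem h) hφ₀
  obtain ⟨M, hM, hΦM, hφ₀M⟩ := exists_isCoatom_of_notMem hφ₀_dir
  have := isSimpleModule_iff_isCoatom.2 hM
  obtain ⟨s, hs⟩ := exists_forall_comp_eq_zero M.mkQ
  refine ⟨s, LinearMap.range_eq_top.1 ?_⟩
  by_contra hrange
  obtain ⟨φ, hφ, hle⟩ := hker _ hrange
  have hφM : φ ∈ M := by simpa using hs φ (LinearMap.range_le_ker_iff.1 hle)
  have hsub : φ - φ₀ ∈ M := hΦM (AffineSubspace.vsub_mem_direction hφ hφ₀)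
  exact hφ₀M (by simpa using M.sub_mem hφM hsub)

end Hom

section Socle

variable {A : Type*} [Ring A] {M K : Type*} [AddCommGroup M] [Module A M] [AddCommGroup K]
  [Module A K]

instance isSemisimpleModule_socle : IsSemisimpleModule A (socle A K) := by
  rw [socle, sSup_eq_iSup]
  exact isSemisimpleModule_biSup_of_isSemisimpleModule_submodule
    fun S (_ : IsSimpleModule A S) => inferInstance

lemma le_socle (N : Submodule A K) [IsSemisimpleModule A N] : N ≤ socle A K := by
  suffices h : ⊤ ≤ (socle A K).comap N.subtype from fun x hx => h (x := ⟨x, hx⟩) trivial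
  rw [← IsSemisimpleModule.sSup_simples_eq_top A N]
  refine sSup_le fun S (_ : IsSimpleModule A S) => Submodule.map_le_iff_le_comap.1 ?_
  exact le_sSup (IsSimpleModule.congr
    (Submodule.equivMapOfInjective N.subtype N.injective_subtype S).symm)

instance isSemisimpleModule_quotient_jacobson [IsArtinian A M] :
    IsSemisimpleModule A (M ⧸ Module.jacobson A M) :=
  (IsArtinian.isSemisimpleModule_iff_jacobson A _).2 (Module.jacobson_quotient_jacobson A M)

lemma eq_top_of_sup_jacobson_eq_top [Module.Finite A M] {N : Submodule A M}
    (hN : N ⊔ Module.jacobson A M = ⊤) : N = ⊤ := by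
  obtain h | ⟨C, hC, hNC⟩ := eq_top_or_exists_le_coatom N
  · exact h
  · exact absurd (top_le_iff.1 (hN ▸ sup_le hNC (sInf_le hC))) hC.1

lemma exists_socle_factorization [IsArtinian A M] {φ : M →ₗ[A] K}
    (hφ : Module.jacobson A M ≤ LinearMap.ker φ) :
    ∃ ψ : (M ⧸ Module.jacobson A M) →ₗ[A] socle A K,
      (socle A K).subtype ∘ₗ ψ ∘ₗ (Module.jacobson A M).mkQ = φ := by
  let φ' := (Module.jacobson A M).liftQ φ hφ
  have : IsSemisimpleModule A (LinearMap.range φ') := .range φ'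
  exact ⟨φ'.codRestrict (socle A K) fun v => le_socle (LinearMap.range φ') ⟨v, rfl⟩, rfl⟩

theorem exists_surjective_socle_quotient_jacobson {R : Type*} [CommRing R] [IsArtinianRing R]
    [Algebra R A] [Module.Finite R A] [Module R M] [IsScalarTower R A M] [Module.Finite A M]
    [Module R K] [IsScalarTower R A K] [Module.Finite A K] (Φ : AffineSubspace R (M →ₗ[A] K))
    (hΦ : 0 ∉ Φ) (hker : ∀ N : Submodule A M, N ≠ ⊤ → ∃ φ ∈ Φ, N ≤ LinearMap.ker φ) :
    ∃ s : socle A K →ₗ[A] M ⧸ Module.jacobson A M, Function.Surjective s := by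
  have : IsArtinianRing A := IsArtinianRing.of_finite R A
  have : Module.Finite R (socle A K) := Module.Finite.trans A _
  let T : ((M ⧸ Module.jacobson A M) →ₗ[A] socle A K) →ₗ[R] M →ₗ[A] K :=
    LinearMap.compRight R (socle A K).subtype ∘ₗ LinearMap.lcomp R _ (Module.jacobson A M).mkQ
  refine exists_surjective_of_affineSubspace (Φ.comap T.toAffineMap) (fun h => hΦ ?_)
    fun N hN => ?_
  · simpa using h
  · obtain ⟨φ, hφ, hNφ⟩ := hker (N.comap (Module.jacobson A M).mkQ) fun h => hN <| by
      rwa [← Submodule.comap_top (Module.jacobson A M).mkQ,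
        (Submodule.comap_injective_of_surjective (Submodule.mkQ_surjective _)).eq_iff] at h
    obtain ⟨ψ, rfl⟩ := exists_socle_factorization ((Submodule.le_comap_mkQ _ N).trans hNφ)
    refine ⟨ψ, hφ, fun x hx => ?_⟩
    obtain ⟨m, rfl⟩ := Submodule.mkQ_surjective _ x
    exact Subtype.ext (hNφ hx)

end Socle

section ProjectiveCover

section Supplement

variable {A : Type*} [Ring A] {F M : Type*} [AddCommGroup F] [Module A F] [AddCommGroup M]
  [Module A M] {p : F →ₗ[A] M} {N : Submodule A F}

lemma range_comp_subtype_eq_top (hN : N.map p = ⊤) : LinearMap.range (p ∘ₗ N.subtype) = ⊤ := by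
  rw [LinearMap.range_comp, N.range_subtype, hN]

lemma eq_top_of_minimal_map_eq_top (hN : Minimal (fun N => N.map p = ⊤) N) {N' : Submodule A N}
    (hN' : N'.map (p ∘ₗ N.subtype) = ⊤) : N' = ⊤ := by
  refine Submodule.map_injective_of_injective N.injective_subtype ?_
  rw [Submodule.map_subtype_top]
  exact hN.eq_of_le (by rwa [← Submodule.map_comp]) (Submodule.map_subtype_le N N')

lemma projective_of_minimal_map_eq_top [Module.Projective A F] [IsNoetherian A F]
    (hN : Minimal (fun N => N.map p = ⊤) N) : Module.Projective A N := by
  have hrange := range_comp_subtype_eq_top hN.prop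
  obtain ⟨g, hg⟩ := Module.projective_lifting_property (p ∘ₗ N.subtype) p
    (LinearMap.range_eq_top.1 hrange)
  have hsurj : LinearMap.range (g ∘ₗ N.subtype) = ⊤ := eq_top_of_minimal_map_eq_top hN <| by
    rw [← LinearMap.range_comp, ← LinearMap.comp_assoc, hg, hrange]
  let e := LinearEquiv.ofBijective _
    (IsNoetherian.bijective_of_surjective_endomorphism _ (LinearMap.range_eq_top.1 hsurj))
  exact .of_split N.subtype (e.symm.toLinearMap ∘ₗ g) (LinearMap.ext e.symm_apply_apply)

lemma isProjectiveCover_of_minimal_map_eq_top [Module.Projective A F] [IsNoetherian A F]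
    (hN : Minimal (fun N => N.map p = ⊤) N) : IsProjectiveCover (p ∘ₗ N.subtype) where
  projective := projective_of_minimal_map_eq_top hN
  surjective := LinearMap.range_eq_top.1 (range_comp_subtype_eq_top hN.prop)
  superfluous _ hN' := eq_top_of_minimal_map_eq_top hN
    ((LinearMap.map_eq_top_iff (range_comp_subtype_eq_top hN.prop)).2 hN')

end Supplement

theorem exists_isProjectiveCover (A : Type u) [Ring A] [IsArtinianRing A] (M : Type v)
    [AddCommGroup M] [Module A M] [Module.Finite A M] :
    ∃ (P : ModuleCat.{u} A) (π : P →ₗ[A] M), IsProjectiveCover π := by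
  obtain ⟨n, p, hp⟩ := Module.Finite.exists_fin' A M
  obtain ⟨N, hN⟩ := exists_minimal_of_wellFoundedLT
    (fun N : Submodule A (Fin n → A) => N.map p = ⊤)
    ⟨⊤, by rwa [Submodule.map_top, LinearMap.range_eq_top]⟩
  exact ⟨ModuleCat.of A N, _, isProjectiveCover_of_minimal_map_eq_top hN⟩

lemma isDirectSummand_of_surjective {A : Type u} [Ring A] {M P : ModuleCat.{v} A}
    [Module.Projective A M] {g : P →ₗ[A] M} (hg : Function.Surjective g) :
    IsDirectSummand M P := by
  obtain ⟨i, hi⟩ := Module.projective_lifting_property g LinearMap.id hg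
  let e := lequivProdOfRightSplitExact (LinearMap.ker g).injective_subtype
    (LinearMap.ker g).range_subtype hi
  let e' : P ≃ₗ[A] M × LinearMap.ker g := e.symm ≪≫ₗ LinearEquiv.prodComm A _ _
  exact ⟨ModuleCat.of A (LinearMap.ker g),
    ⟨e'.toModuleIso ≪≫ (ModuleCat.biprodIsoProd M (ModuleCat.of A (LinearMap.ker g))).symm⟩⟩

theorem isDirectSummand_of_surjective_quotient_jacobson {A : Type u} [Ring A]
    {M P : ModuleCat.{v} A} [Module.Finite A M] [Module.Projective A M] [Module.Projective A P]
    {q : P →ₗ[A] M ⧸ Module.jacobson A M} (hq : Function.Surjective q) :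
    IsDirectSummand M P := by
  obtain ⟨g, hg⟩ := Module.projective_lifting_property (Module.jacobson A M).mkQ q
    (Submodule.mkQ_surjective _)
  have hrange : LinearMap.range g ⊔ Module.jacobson A M = ⊤ := by
    rw [← LinearMap.range_eq_top, ← hg, LinearMap.range_comp,
      LinearMap.map_eq_top_iff (Submodule.range_mkQ _), Submodule.ker_mkQ] at hq
    exact hq
  exact isDirectSummand_of_surjective
    (LinearMap.range_eq_top.1 (eq_top_of_sup_jacobson_eq_top hrange))

end ProjectiveCover

section Transport

variable {C : Type*} [Category C] [HasZeroMorphisms C] {ι : Type*} {c : ComplexShape ι}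
  {K L : HomologicalComplex C c} {M : ι → C} {a : ∀ i, M i ⟶ K.X i} {k : ∀ i, K.X i ⟶ M i}

variable (K M a k) in
/-- The complex with terms `M i` and the differential of `K` transported along the maps `a` and
`k`. These need not be inverse to each other: it is enough that `k ≫ a` is invisible to the
differentials of `K`. -/
abbrev transport (h : ∀ i j, K.d i j ≫ k j ≫ a j = K.d i j) : HomologicalComplex C c where
  X := M
  d i j := a i ≫ K.d i j ≫ k j
  shape i j hij := by rw [K.shape i j hij, zero_comp, comp_zero]
  d_comp_d' i j l _ _ := by simp [reassoc_of% h]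

variable (h : ∀ i j, K.d i j ≫ k j ≫ a j = K.d i j)

/-- The comparison map from the transported complex to the original one. -/
def transportHom : transport K M a k h ⟶ K where
  f := a
  comm' i j _ := by simp [h]

/-- A morphism to `K` that is fixed by `k ≫ a` factors through the transported complex. -/
def transportLift (f : L ⟶ K) (hf : ∀ i, f.f i ≫ k i ≫ a i = f.f i) :
    L ⟶ transport K M a k h where
  f i := f.f i ≫ k i
  comm' i j _ := by simp [reassoc_of% hf]

lemma transportLift_comp_transportHom (f : L ⟶ K) (hf : ∀ i, f.f i ≫ k i ≫ a i = f.f i) :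
    transportLift h f hf ≫ transportHom h = f := by
  ext1 i
  exact (Category.assoc _ _ _).trans (hf i)

/-- The components of a morphism out of the transported complex, precomposed with the maps `k`. In
general they commute with the differentials only in the degrees where `k ≫ a` is the identity. -/
def transportRestrict (ρ : transport K M a k h ⟶ L) (i : ι) : K.X i ⟶ L.X i :=
  k i ≫ ρ.f i

lemma comp_d_comp_transportRestrict (ρ : transport K M a k h ⟶ L) (i j : ι) :
    a i ≫ K.d i j ≫ transportRestrict h ρ j = ρ.f i ≫ L.d i j := by
  simp [transportRestrict, ρ.comm i j]

lemma transportRestrict_comm (ρ : transport K M a k h ⟶ L) {i : ι} (hi : k i ≫ a i = 𝟙 _) (j : ι) :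
    transportRestrict h ρ i ≫ L.d i j = K.d i j ≫ transportRestrict h ρ j := by
  rw [transportRestrict, Category.assoc, ← comp_d_comp_transportRestrict, reassoc_of% hi]

lemma comp_transportRestrict {f : L ⟶ K} {hf : ∀ i, f.f i ≫ k i ≫ a i = f.f i}
    {ρ : transport K M a k h ⟶ L} (hρ : transportLift h f hf ≫ ρ = 𝟙 L) (i : ι) :
    f.f i ≫ transportRestrict h ρ i = 𝟙 (L.X i) :=
  (Category.assoc _ _ _).symm.trans (HomologicalComplex.congr_hom hρ i)

end Transport

section ReplaceZero

variable {C : Type*}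

/-- The family `K` with the term in degree `0` replaced by `P`. -/
def replaceZeroX (K : ℤ → C) (P : C) : ℤ → C
  | .ofNat 0 => P
  | .ofNat (i + 1) => K (i + 1 : ℕ)
  | .negSucc i => K (.negSucc i)

variable {K : ℤ → C} {P : C}

lemma replaceZeroX_of_ne_zero {i : ℤ} (hi : i ≠ 0) : replaceZeroX K P i = K i := by
  obtain (_ | i) | i := i
  · exact absurd rfl hi
  · rfl
  · rfl

variable [Category C] [HasZeroMorphisms C]

/-- The comparison map given by `p` in degree `0` and by the identity elsewhere. -/
def replaceZeroTo (p : P ⟶ K 0) : ∀ i, replaceZeroX K P i ⟶ K i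
  | .ofNat 0 => p
  | .ofNat (i + 1) => 𝟙 (K (i + 1 : ℕ))
  | .negSucc i => 𝟙 (K (.negSucc i))

/-- The comparison map given by zero in degree `0` and by the identity elsewhere. -/
def replaceZeroFrom : ∀ i, K i ⟶ replaceZeroX K P i
  | .ofNat 0 => 0
  | .ofNat (i + 1) => 𝟙 (K (i + 1 : ℕ))
  | .negSucc i => 𝟙 (K (.negSucc i))

lemma replaceZeroFrom_comp_replaceZeroTo (p : P ⟶ K 0) {i : ℤ} (hi : i ≠ 0) :
    replaceZeroFrom i ≫ replaceZeroTo p i = 𝟙 (K i) := by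
  obtain (_ | i) | i := i
  · exact absurd rfl hi
  · exact Category.comp_id _
  · exact Category.comp_id _

end ReplaceZero

section Replacement

variable {A : Type u} [Ring A] {n : ℤ} {X : Cplx A 1 n} {Z : Cplx A 0 n}

lemma isZero_X_of_le_zero (X : Cplx A 1 n) {i : ℤ} (hi : i ≤ 0) : IsZero (X.obj.X i) :=
  X.property.2 i fun h => by linarith [h.1]

variable {P : ModuleCat.{u} A} (p : P ⟶ Z.obj.X 0)

lemma d_comp_replaceZero (i j : ℤ) :
    Z.obj.d i j ≫ replaceZeroFrom j ≫ replaceZeroTo p j = Z.obj.d i j := by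
  obtain rfl | hj := eq_or_ne j 0
  · have hd : Z.obj.d i 0 = 0 := by
      by_cases hi : i + 1 = 0
      · exact (Z.property.2 i fun h => by linarith [h.1]).eq_of_src _ _
      · exact Z.obj.shape i 0 hi
    rw [hd, zero_comp]
  · rw [replaceZeroFrom_comp_replaceZeroTo p hj, Category.comp_id]

lemma hom_comp_replaceZero (f : (incl A n).obj X ⟶ Z) (i : ℤ) :
    f.hom.f i ≫ replaceZeroFrom i ≫ replaceZeroTo p i = f.hom.f i := by
  obtain rfl | hi := eq_or_ne i 0
  · exact (isZero_X_of_le_zero X le_rfl).eq_of_src _ _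
  · rw [replaceZeroFrom_comp_replaceZeroTo p hi, Category.comp_id]

variable [Module.Finite A P] [Module.Projective A P] (hn : 0 ≤ n)

/-- The complex obtained from `Z` by replacing the term `Z⁰` by a finitely generated projective
module `P` along a map `p : P ⟶ Z⁰`. -/
abbrev replaceZero : Cplx A 0 n where
  obj := transport Z.obj _ (replaceZeroTo p) replaceZeroFrom (d_comp_replaceZero p)
  property := by
    refine ⟨fun i => ?_, fun i hi => ?_⟩
    · obtain rfl | hi := eq_or_ne i 0
      · exact ⟨‹Module.Finite A P›, ‹Module.Projective A P›⟩
      · rw [show (transport ..).X i = Z.obj.X i from replaceZeroX_of_ne_zero hi]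
        exact Z.property.1 i
    · have hi₀ : i ≠ 0 := fun h => hi ⟨h.ge, h.trans_le hn⟩
      exact (Z.property.2 i hi).of_iso (eqToIso (replaceZeroX_of_ne_zero hi₀))

/-- The comparison map from the complex with `Z⁰` replaced to `Z`. -/
def replaceZeroHom : replaceZero p hn ⟶ Z :=
  ObjectProperty.homMk (transportHom (d_comp_replaceZero p))

/-- Every morphism from a complex without term in degree `0` lifts along the comparison map. -/
def replaceZeroLift (f : (incl A n).obj X ⟶ Z) : (incl A n).obj X ⟶ replaceZero p hn :=
  ObjectProperty.homMk
    (transportLift (d_comp_replaceZero p) f.hom (hom_comp_replaceZero p f))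

lemma replaceZeroLift_comp_replaceZeroHom (f : (incl A n).obj X ⟶ Z) :
    replaceZeroLift p hn f ≫ replaceZeroHom p hn = f :=
  ObjectProperty.hom_ext _
    (transportLift_comp_transportHom _ f.hom (hom_comp_replaceZero p f))

lemma surjective_of_isSplitEpi_replaceZeroHom [IsSplitEpi (replaceZeroHom p hn)] :
    Function.Surjective p := fun z =>
  ⟨(section_ (replaceZeroHom p hn)).hom.f 0 z, ConcreteCategory.congr_hom
    (congrArg (fun g => g.hom.f 0) (IsSplitEpi.id (replaceZeroHom p hn))) z⟩

end Replacement

section TailRetraction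

variable {A : Type u} [Ring A] {n : ℤ} {X : Cplx A 1 n} {Z : Cplx A 0 n}
  {f : (incl A n).obj X ⟶ Z}

/-- A family of maps `Zⁱ → Xⁱ` that is a retraction of `f` in every degree and commutes with the
differentials starting in degrees `≥ 1`: a retraction of the hard truncation of `f`. -/
structure IsTailRetraction (f : (incl A n).obj X ⟶ Z) (r : ∀ i, Z.obj.X i →ₗ[A] X.obj.X i) :
    Prop where
  comm : ∀ i j, 1 ≤ i → ∀ z, X.obj.d i j (r i z) = r j (Z.obj.d i j z)
  retraction : ∀ i x, r i (f.hom.f i x) = x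

namespace IsTailRetraction

variable {r r₁ r₂ r₃ : ∀ i, Z.obj.X i →ₗ[A] X.obj.X i}

lemma mem_ker (hr : IsTailRetraction f r) (z : Z.obj.X 0) :
    r 1 (Z.obj.d 0 1 z) ∈ LinearMap.ker (X.obj.d 1 2).hom := by
  have hd : Z.obj.d 1 2 (Z.obj.d 0 1 z) = 0 :=
    ConcreteCategory.congr_hom (Z.obj.d_comp_d 0 1 2) z
  rw [LinearMap.mem_ker, hr.comm 1 2 le_rfl, hd, map_zero]

lemma isSplitMono (hr : IsTailRetraction f r) (hr₀ : ∀ z, r 1 (Z.obj.d 0 1 z) = 0) :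
    IsSplitMono f := by
  have hcomm (i j : ℤ) (hij : i + 1 = j) :
      ModuleCat.ofHom (r i) ≫ X.obj.d i j = Z.obj.d i j ≫ ModuleCat.ofHom (r j) := by
    obtain hj | rfl | hi : j ≤ 0 ∨ j = 1 ∨ 1 ≤ i := by omega
    · exact (isZero_X_of_le_zero X hj).eq_of_tgt _ _
    · obtain rfl : i = 0 := by omega
      rw [(isZero_X_of_le_zero X le_rfl).eq_of_src (X.obj.d 0 1) 0, comp_zero]
      ext z
      exact (hr₀ z).symm
    · ext z
      exact hr.comm i j hi z
  let ρ : Z ⟶ (incl A n).obj X := ObjectProperty.homMk ⟨fun i => ModuleCat.ofHom (r i), hcomm⟩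
  refine ⟨⟨⟨ρ, ?_⟩⟩⟩
  ext i x
  exact hr.retraction i x

lemma smul_sub_add {R : Type*} [CommRing R] [Algebra R A] [∀ M : ModuleCat.{u} A, Module R M]
    [∀ M : ModuleCat.{u} A, IsScalarTower R A M] (hr₁ : IsTailRetraction f r₁)
    (hr₂ : IsTailRetraction f r₂) (hr₃ : IsTailRetraction f r₃) (c : R) :
    IsTailRetraction f fun i => c • (r₁ i - r₂ i) + r₃ i where
  comm i j hi z := by
    have hsmul := (X.obj.d i j).hom.map_smul_of_tower c (r₁ i z - r₂ i z)
    simp [hsmul, hr₁.comm i j hi, hr₂.comm i j hi, hr₃.comm i j hi]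
  retraction i x := by simp [hr₁.retraction, hr₂.retraction, hr₃.retraction]

end IsTailRetraction

/-- The `R`-affine space of the maps `r¹ ∘ d⁰ : Z⁰ → Ker d¹`, for the tail retractions `r`
of `f`. -/
def tailRetractionSpace (R : Type*) [CommRing R] [Algebra R A]
    [∀ M : ModuleCat.{u} A, Module R M] [∀ M : ModuleCat.{u} A, IsScalarTower R A M]
    (f : (incl A n).obj X ⟶ Z) :
    AffineSubspace R (Z.obj.X 0 →ₗ[A] LinearMap.ker (X.obj.d 1 2).hom) where
  carrier := {φ | ∃ r, IsTailRetraction f r ∧ ∀ z, (φ z : X.obj.X 1) = r 1 (Z.obj.d 0 1 z)}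
  smul_vsub_vadd_mem' := by
    rintro c φ₁ φ₂ φ₃ ⟨r₁, hr₁, hφ₁⟩ ⟨r₂, hr₂, hφ₂⟩ ⟨r₃, hr₃, hφ₃⟩
    exact ⟨_, hr₁.smul_sub_add hr₂ hr₃ c, fun z => by simp [hφ₁, hφ₂, hφ₃]⟩

section

variable {hn : 0 ≤ n} {P : ModuleCat.{u} A} [Module.Finite A P] [Module.Projective A P]
  {p : P ⟶ Z.obj.X 0} (ρ : replaceZero p hn ⟶ (incl A n).obj X)

lemma isTailRetraction_transportRestrict (hρ : replaceZeroLift p hn f ≫ ρ = 𝟙 _) :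
    IsTailRetraction f fun i => (transportRestrict (d_comp_replaceZero p) ρ.hom i).hom where
  comm i j hi := ConcreteCategory.congr_hom (transportRestrict_comm _ ρ.hom
    (replaceZeroFrom_comp_replaceZeroTo p (by omega)) j)
  retraction i := ConcreteCategory.congr_hom
    (comp_transportRestrict _ (hf := hom_comp_replaceZero p f)
      (congrArg InducedCategory.Hom.hom hρ) i)

lemma comp_d_comp_transportRestrict_eq_zero :
    p ≫ Z.obj.d 0 1 ≫ transportRestrict (d_comp_replaceZero p) ρ.hom 1 = 0 := by
  have hd : X.obj.d 0 1 = 0 := (isZero_X_of_le_zero X le_rfl).eq_of_src _ _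
  calc
    _ = ρ.hom.f 0 ≫ X.obj.d 0 1 := comp_d_comp_transportRestrict _ ρ.hom 0 1
    _ = 0 := (congrArg (ρ.hom.f 0 ≫ ·) hd).trans comp_zero

end

theorem IsIrreducible.exists_isTailRetraction [IsNoetherianRing A] (hf : IsIrreducible f)
    {N : Submodule A (Z.obj.X 0)} (hN : N ≠ ⊤) :
    ∃ r, IsTailRetraction f r ∧ ∀ z ∈ N, r 1 (Z.obj.d 0 1 z) = 0 := by
  have hn : 0 ≤ n := by
    by_contra hn
    have := ModuleCat.subsingleton_of_isZero (Z.property.2 0 fun h => hn h.2)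
    exact hN (Subsingleton.elim _ _)
  have := (Z.property.1 0).1
  obtain ⟨m, p₀, hp₀⟩ := Module.Finite.exists_fin' A N
  let p : ModuleCat.of A (Fin m → A) ⟶ Z.obj.X 0 := ModuleCat.ofHom (N.subtype ∘ₗ p₀)
  obtain ⟨⟨⟨ρ⟩⟩⟩ | hepi := hf.factor _ _ (replaceZeroLift_comp_replaceZeroHom p hn f)
  · refine ⟨_, isTailRetraction_transportRestrict ρ.retraction ρ.id, fun z hz => ?_⟩
    obtain ⟨y, hy⟩ := hp₀ ⟨z, hz⟩
    obtain rfl : p y = z := congrArg Subtype.val hy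
    exact ConcreteCategory.congr_hom (comp_d_comp_transportRestrict_eq_zero ρ.retraction) y
  · refine absurd (Submodule.eq_top_iff'.2 fun z => ?_) hN
    obtain ⟨y, rfl⟩ := surjective_of_isSplitEpi_replaceZeroHom p hn z
    exact (p₀ y).2

theorem IsIrreducible.exists_surjective_socKer (R : Type*) [CommRing R] [IsArtinianRing R]
    [Algebra R A] [Module.Finite R A] (hf : IsIrreducible f) :
    ∃ s : socKer X →ₗ[A] Z.obj.X 0 ⧸ Module.jacobson A (Z.obj.X 0), Function.Surjective s := by
  have : IsArtinianRing A := IsArtinianRing.of_finite R A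
  let (M : ModuleCat.{u} A) : Module R M := Module.restrictScalars R A M
  have (M : ModuleCat.{u} A) : IsScalarTower R A M := IsScalarTower.restrictScalars R A M
  have := (Z.property.1 0).1
  have := (X.property.1 1).1
  refine exists_surjective_socle_quotient_jacobson (tailRetractionSpace R f) ?_ fun N hN => ?_
  · rintro ⟨r, hr, hr₀⟩
    exact hf.not_section (hr.isSplitMono fun z => (hr₀ z).symm)
  · obtain ⟨r, hr, hrN⟩ := hf.exists_isTailRetraction hN
    exact ⟨(r 1 ∘ₗ (Z.obj.d 0 1).hom).codRestrict _ hr.mem_ker, ⟨r, hr, fun _ => rfl⟩,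
      fun z hz => Subtype.ext (hrN z hz)⟩

end TailRetraction

end ProjComplexes

theorem proposition4p1_general {R : Type v} [CommRing R] [IsArtinianRing R]
    {A : Type u} [Ring A] [Algebra R A] [Module.Finite R A] (n : ℤ)
    (X : ProjComplexes.Cplx A 1 n) (Z : ProjComplexes.Cplx A 0 n)
    (f : (ProjComplexes.incl A n).obj X ⟶ Z) (hf : ProjComplexes.IsIrreducible f) :
    (∃ (P : ModuleCat.{u} A) (π : P →ₗ[A] ProjComplexes.socKer X),
      ProjComplexes.IsProjectiveCover π) ∧
    ∀ (P : ModuleCat.{u} A) (π : P →ₗ[A] ProjComplexes.socKer X),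
      ProjComplexes.IsProjectiveCover π →
        ProjComplexes.IsDirectSummand (Z.obj.X 0) P := by
  have : IsArtinianRing A := IsArtinianRing.of_finite R A
  have : Module.Finite A (X.obj.X 1) := (X.property.1 1).1
  obtain ⟨_, _⟩ := Z.property.1 0
  refine ⟨ProjComplexes.exists_isProjectiveCover A _, fun P π hπ => ?_⟩
  have := hπ.projective
  obtain ⟨s, hs⟩ := hf.exists_surjective_socKer R
  have hsπ : Function.Surjective (s ∘ₗ π) := hs.comp hπ.surjective
  exact ProjComplexes.isDirectSummand_of_surjective_quotient_jacobson hsπ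

theorem proposition4p1 {R : Type v} [CommRing R] [IsArtinianRing R]
    {A : Type u} [Ring A] [Algebra R A] [Module.Finite R A]
    (n : ℤ) (hn : 1 ≤ n)
    (X Y : ProjComplexes.Cplx A 1 n) (hX : Indecomposable X)
    (Z : ProjComplexes.Cplx A 0 n) (hZ : ProjComplexes.IsLeftEnlargement X Z)
    (D : ProjComplexes.DiagonalForm X Y Z)
    (f : (ProjComplexes.incl A n).obj X ⟶ Z) (hf : ProjComplexes.IsIrreducible f) :
    (∃ (P : ModuleCat.{u} A) (π : P →ₗ[A] ProjComplexes.socKer X),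
      ProjComplexes.IsProjectiveCover π) ∧
    ∀ (P : ModuleCat.{u} A) (π : P →ₗ[A] ProjComplexes.socKer X),
      ProjComplexes.IsProjectiveCover π →
        ProjComplexes.IsDirectSummand (Z.obj.X 0) P :=
  proposition4p1_general (R := R) n X Z f hf
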